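/- Fix $\sigma>0$ and $\delta\in\mathbb R$. Let $\Lambda_k\subset\mathbb R^{n_k}$ ($k\ge 0$) be full-rank lattices of dimensions $n_k\ge 1$ with $n_k\to\infty$, all of normalized log density $\delta$, i.e. $\det\Lambda_k=e^{-n_k\delta}$. (The usual indexing by the dimension is $n_k=k+1$; sequences existing only in some dimensions are included.) For a lattice $\Lambda$ of dimension $n$ and normalized log density $\delta$, let $0=\lambda_0<\lambda_1<\lambda_2<\cdots$ be the distinct norms of its vectors, $\mathcal N_j$ the number of vectors of norm $\lambda_j$, $\widetilde\lambda_j=e^{\delta}\lambda_j$, and $V_n$ the volume of the unit ball of $\mathbb R^n$. For $x>0$ set $$\alpha^{\rm rng}(x)=\frac{\mathcal N_j}{V_n(\widetilde\lambda_j^{\,n}-\widetilde\lambda_{j-1}^{\,n})}\qquad\text{if }\widetilde\lambda_{j-1}<x\le\widetilde\lambda_j,\ j\ge1 .$$ Let $$\alpha=\frac{\mathcal N_1}{e^{n\delta}V_n\lambda_1^n},\qquad r=(\alpha\, e^{n\delta}V_n)^{-1/n}.$$ Write $\mathcal N_1[k],\lambda_1[k],\alpha^{\rm rng}_k,r_k$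 for these quantities for $\Lambda_k$. Let $P_e(\Lambda)$ be the error probability of maximum-likelihood (nearest lattice point) decoding of $\Lambda$ over the additive white Gaussian noise channel with noise variance $\sigma^2$ per coordinate, i.e. the probability that the noise vector does not lie in the open Voronoi cell of $0$. Let $$E_r(\delta)=\begin{cases}(\delta^*-\delta)+\tfrac12\log\tfrac e4, & \delta\le\delta_{cr},\\ \tfrac12\left(e^{2(\delta^*-\delta)}-2(\delta^*-\delta)-1\right), & \delta_{cr}\le\delta<\delta^*,\\ 0,&\delta\ge\delta^*,\end{cases}\qquad \delta^*=\tfrac12\log\tfrac1{2\pi e\sigma^2},\quad \delta_{cr}=\tfrac12\log\tfrac1{4\pi e\sigma^2}$$ be the unrestricted-channel (Poltyrev random-coding) error exponent. Suppose that for every $k$ the function $\alpha^{\rm rng}_k$ is non-increasing on $0<x\le 2e^{\delta}r_k$ (for instance, non-increasing on all of $(0,\infty)$), and that $$\lim_{k\to\infty}\frac1{n_k}\log\left(\frac{\mathcal N_1[k]}{e^{n_k\delta}V_{n_k}(\lambda_1[k])^{n_k}}\right)=0 .$$ Then the sequence achieves the unrestricted-channel error exponent: there are $\varepsilon_k\to0$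 with $$P_e(\Lambda_k)\le e^{-n_k(E_r(\delta)+\varepsilon_k)}\qquad\text{for all }k .$$ -/

import Mathlib

open MeasureTheory ProbabilityTheory Filter Topology

noncomputable section

namespace LatticeExponent

/-- A (full-rank) lattice in `ℝⁿ` is a `ℤ`-submodule `L` of Euclidean space with
`[DiscreteTopology L]` and `[IsZLattice ℝ L]`. This abbreviation names the ambient space. -/
abbrev Space (n : ℕ) : Type := EuclideanSpace ℝ (Fin n)

/-- `V_n`, the volume of the unit ball of `ℝⁿ`. -/
def unitBallVol (n : ℕ) : ℝ := (volume : Measure (Space n)).real (Metric.ball 0 1)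

/-- The normalized log density `δ` of a lattice: `e^{nδ} = (det L)⁻¹`, where `det L` is the
volume of a fundamental parallelepiped. -/
def nld {n : ℕ} (L : Submodule ℤ (Space n)) : ℝ :=
  -Real.log (ZLattice.covolume L) / n

/-- The distance series `λ_0 = 0 < λ_1 < λ_2 < ⋯` of the distinct norms of lattice vectors:
`λ_{j+1}` is the least norm exceeding `λ_j` (attained, since `L` is discrete). -/
def normSeries {n : ℕ} (L : Submodule ℤ (Space n)) : ℕ → ℝ
  | 0 => 0
  | j + 1 => sInf {r : ℝ | normSeries L j < r ∧ ∃ x ∈ L, ‖x‖ = r}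

/-- The distance spectrum: `𝒩_j` is the number of lattice vectors of norm `λ_j`. -/
def mult {n : ℕ} (L : Submodule ℤ (Space n)) (j : ℕ) : ℕ :=
  Set.ncard {x : Space n | x ∈ L ∧ ‖x‖ = normSeries L j}

/-- The distance series of the normalized lattice `e^δ L`, which has determinant one. -/
def normDist {n : ℕ} (L : Submodule ℤ (Space n)) (j : ℕ) : ℝ :=
  Real.exp (nld L) * normSeries L j

/-- The function `α^rng`. For `x` in the shell `λ̃_{j-1} < x ≤ λ̃_j` (`j ≥ 1`), its value is
`𝒩_j / (V_n (λ̃_j ^ n - λ̃_{j-1} ^ n))`; it is zero for `x ≤ 0`.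
For `x > 0` the index of the shell is the least `j` with `x ≤ λ̃_j`; since `λ̃_0 = 0`, it is
at least one. -/
def alphaRng {n : ℕ} (L : Submodule ℤ (Space n)) (x : ℝ) : ℝ :=
  if 0 < x then
    let j := sInf {j : ℕ | x ≤ normDist L j}
    (mult L j : ℝ) / (unitBallVol n * (normDist L j ^ n - normDist L (j - 1) ^ n))
  else 0

/-- The number `𝒩_1 / (e^{nδ} V_n λ_1 ^ n)`. -/
def alphaOne {n : ℕ} (L : Submodule ℤ (Space n)) : ℝ :=
  (mult L 1 : ℝ) / (Real.exp (n * nld L) * unitBallVol n * normSeries L 1 ^ n)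

/-- The decoding radius `r = (α β V_n)^{-1/n}` at which the spectral union bound is evaluated,
with `β = e^{nδ}` the density of the lattice and `α = 𝒩_1 / (e^{nδ} V_n λ_1 ^ n)`. -/
def radius {n : ℕ} (L : Submodule ℤ (Space n)) : ℝ :=
  (alphaOne L * Real.exp (n * nld L) * unitBallVol n) ^ (-(1 / (n : ℝ)))

/-- Additive white Gaussian noise of variance `σ²` per coordinate: the law on `ℝⁿ` of a vector
with independent `N(0, σ²)` coordinates. -/
def awgn (σ : ℝ) (n : ℕ) : Measure (Space n) :=
  (Measure.pi fun _ : Fin n => gaussianReal 0 (Real.toNNReal (σ ^ 2))).map (WithLp.toLp 2)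

/-- The (open) Voronoi cell of the origin: the points strictly closer to `0` than to every
other lattice point. -/
def voronoi {n : ℕ} (L : Submodule ℤ (Space n)) : Set (Space n) :=
  {z | ∀ x ∈ L, x ≠ 0 → ‖z‖ < ‖z - x‖}

/-- The error probability of maximum-likelihood (nearest lattice point) decoding over the AWGN
channel: the probability that the noise leaves the Voronoi cell. By translation invariance it
does not depend on the transmitted lattice point; ties are counted as errors. -/
def errorProb (σ : ℝ) {n : ℕ} (L : Submodule ℤ (Space n)) : ℝ :=
  (awgn σ n).real (voronoi L)ᶜ

/-- The capacity `δ* = ½ log (1 / (2πeσ²))` of the unrestricted AWGN channel. -/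
def deltaStar (σ : ℝ) : ℝ :=
  1 / 2 * Real.log (1 / (2 * Real.pi * Real.exp 1 * σ ^ 2))

/-- The critical normalized log density `δ_cr = ½ log (1 / (4πeσ²))`. -/
def deltaCr (σ : ℝ) : ℝ :=
  1 / 2 * Real.log (1 / (4 * Real.pi * Real.exp 1 * σ ^ 2))

/-- Poltyrev's random-coding error exponent `E_r(δ)` of the unrestricted AWGN channel. -/
def errorExponent (σ δ : ℝ) : ℝ :=
  if δ ≤ deltaCr σ then
    (deltaStar σ - δ) + 1 / 2 * Real.log (Real.exp 1 / 4)
  else if δ < deltaStar σ then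
    (Real.exp (2 * (deltaStar σ - δ)) - 2 * (deltaStar σ - δ) - 1) / 2
  else 0

/-- A sequence of lattices of dimensions `d k` and common normalized log density `δ` achieves
the unrestricted-channel error exponent if `P_e ≤ e^{-n (E_r(δ) + o(1))}`, `n = d k`. -/
def AchievesErrorExponent (σ δ : ℝ) (d : ℕ → ℕ)
    (Λ : (k : ℕ) → Submodule ℤ (Space (d k))) : Prop :=
  ∃ ε : ℕ → ℝ, Tendsto ε atTop (𝓝 0) ∧
    ∀ k, errorProb σ (Λ k) ≤ Real.exp (-((d k : ℝ) * (errorExponent σ δ + ε k)))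

end LatticeExponent

end

namespace LatticeExponent

/-! Monotonicity bounds the density of every shell out to radius `2r` by that of the first, which is
`α`. The shell volumes telescope, so at most `α e^{nδ} V_n ρ^n` nonzero lattice points have norm at
most `ρ ≤ 2r` (`ncard_norm_le`): up to the factor `α`, the mean count of a random point set of the
lattice's density.

Let `Z` be the noise. By isotropy, the probability that `Z` lies in the ball of radius `r` and is at
least as close to `x` as to `0` is a non-increasing function of `‖x‖`. The counting bound therefore
dominates the union bound by an integral over all `x`, and Fubini turns that into the integral of `C
V_n ‖Z‖^n` over `‖Z‖ ≤ r`, with `C = α e^{nδ}`. The radius `r` is where this integrand reaches one;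
beyond it, decoding is counted as failed. Hence `P_e ≤ E min(1, C V_n ‖Z‖^n)`
(`awgn_compl_voronoi_le`).

With `V_n ≤ (2πe/n)^{n/2}` and `w = ‖Z‖²/(nσ²)`, the integrand is at most `min(1, (w/e^t)^{n/2})`,
where `t = 2(δ* - δ) - (2/n) log α`. A Chernoff bound, resting on the scalar inequality
`exists_min_log_le`, gives `exp(-n · exponentFun t)` (`errorProb_le`). Since `(1/n) log α → 0` and
`exponentFun` is continuous, the exponent tends to `E_r(δ)`. -/

variable {n : ℕ}

/-! ### Distance series of a lattice -/

lemma finite_norm_le (L : Submodule ℤ (Space n)) [DiscreteTopology L] (R : ℝ) :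
    {x : Space n | x ∈ L ∧ ‖x‖ ≤ R}.Finite := by
  have hc : IsClosed (L : Set (Space n)) := @AddSubgroup.isClosed_of_discrete _ _ _ _ _
    L.toAddSubgroup (inferInstanceAs (DiscreteTopology L))
  have h := Metric.finite_isBounded_inter_isClosed (s := (L : Set (Space n)))
    (isDiscrete_iff_discreteTopology.2 (inferInstanceAs (DiscreteTopology L)))
    (Metric.isBounded_closedBall (x := (0 : Space n)) (r := R)) hc
  refine h.subset fun x hx => ⟨by simpa using hx.2, hx.1⟩

lemma exists_mem_norm_gt (hn : 0 < n) (L : Submodule ℤ (Space n)) [DiscreteTopology L]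
    [IsZLattice ℝ L] (R : ℝ) : ∃ x ∈ L, R < ‖x‖ := by
  have hne : ∃ x ∈ L, x ≠ 0 := by
    by_contra! h
    have h1 : Submodule.span ℝ (L : Set (Space n)) = ⊤ := IsZLattice.span_top
    have h2 : Submodule.span ℝ (L : Set (Space n)) = ⊥ := Submodule.span_eq_bot.2 h
    have : Nonempty (Fin n) := ⟨⟨0, hn⟩⟩
    have : Nontrivial (Space n) := inferInstance
    exact bot_ne_top (h2.symm.trans h1)
  obtain ⟨x, hx, hx0⟩ := hne
  obtain ⟨k, hk⟩ := exists_nat_gt (R / ‖x‖)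
  refine ⟨k • x, L.nsmul_mem hx k, ?_⟩
  rw [div_lt_iff₀ (norm_pos_iff.2 hx0)] at hk
  rwa [← Nat.cast_smul_eq_nsmul ℝ, norm_smul, Real.norm_natCast]

/-- A nonzero lattice has arbitrarily long vectors, so the infimum is over a nonempty set;
discreteness leaves finitely many norms below any bound, so it is attained. -/
lemma isLeast_normSeries_succ (hn : 0 < n) (L : Submodule ℤ (Space n)) [DiscreteTopology L]
    [IsZLattice ℝ L] (j : ℕ) :
    IsLeast {r : ℝ | normSeries L j < r ∧ ∃ x ∈ L, ‖x‖ = r} (normSeries L (j + 1)) := by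
  set T := {r : ℝ | normSeries L j < r ∧ ∃ x ∈ L, ‖x‖ = r} with hT
  obtain ⟨x, hx, hxr⟩ := exists_mem_norm_gt hn L (normSeries L j)
  have hfin : (T ∩ Set.Iic ‖x‖).Finite := by
    refine ((finite_norm_le L ‖x‖).image norm).subset ?_
    rintro r ⟨⟨_, y, hy, rfl⟩, hr⟩
    exact ⟨y, ⟨hy, hr⟩, rfl⟩
  obtain ⟨a, ha⟩ := hfin.exists_minimal ⟨‖x‖, ⟨hxr, x, hx, rfl⟩, Set.mem_Iic.2 le_rfl⟩
  have hleast : IsLeast T a := by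
    refine ⟨ha.prop.1, fun b hb => ?_⟩
    by_contra! hba
    exact hba.not_ge (ha.le_of_le ⟨hb, hba.le.trans ha.prop.2⟩ hba.le)
  have : normSeries L (j + 1) = a := hleast.csInf_eq
  rwa [this]

lemma normSeries_strictMono (hn : 0 < n) (L : Submodule ℤ (Space n)) [DiscreteTopology L]
    [IsZLattice ℝ L] : StrictMono (normSeries L) :=
  strictMono_nat_of_lt_succ fun j => (isLeast_normSeries_succ hn L j).1.1

lemma normSeries_nonneg (hn : 0 < n) (L : Submodule ℤ (Space n)) [DiscreteTopology L]
    [IsZLattice ℝ L] (j : ℕ) : 0 ≤ normSeries L j :=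
  (normSeries_strictMono hn L).monotone (Nat.zero_le j)

lemma normSeries_pos (hn : 0 < n) (L : Submodule ℤ (Space n)) [DiscreteTopology L]
    [IsZLattice ℝ L] {j : ℕ} (hj : j ≠ 0) : 0 < normSeries L j :=
  (normSeries_strictMono hn L) (Nat.pos_of_ne_zero hj)

lemma exists_norm_eq_normSeries (hn : 0 < n) (L : Submodule ℤ (Space n)) [DiscreteTopology L]
    [IsZLattice ℝ L] (j : ℕ) : ∃ x ∈ L, ‖x‖ = normSeries L j := by
  cases j with
  | zero => exact ⟨0, L.zero_mem, by simp [normSeries]⟩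
  | succ j => exact (isLeast_normSeries_succ hn L j).1.2

/-- Every norm of a lattice vector occurs in the distance series. -/
lemma exists_normSeries_eq_norm (hn : 0 < n) (L : Submodule ℤ (Space n)) [DiscreteTopology L]
    [IsZLattice ℝ L] {x : Space n} (hx : x ∈ L) : ∃ j, normSeries L j = ‖x‖ := by
  by_contra! h
  -- A norm that is skipped stays above the whole series, since each term is the least norm after
  -- its predecessor; infinitely many norms would then be bounded.
  have hlt : ∀ j, normSeries L j < ‖x‖ := by
    intro j
    induction j with
    | zero => exact lt_of_le_of_ne (norm_nonneg x) (h 0)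
    | succ j ih =>
      exact lt_of_le_of_ne ((isLeast_normSeries_succ hn L j).2 ⟨ih, x, hx, rfl⟩) (h _)
  have hfin : (Set.range (normSeries L)).Finite := by
    refine ((finite_norm_le L ‖x‖).image norm).subset ?_
    rintro _ ⟨j, rfl⟩
    obtain ⟨y, hy, hyj⟩ := exists_norm_eq_normSeries hn L j
    exact ⟨y, ⟨hy, hyj ▸ (hlt j).le⟩, hyj⟩
  exact Set.infinite_range_of_injective (normSeries_strictMono hn L).injective hfin

/-! ### The constants `V_n`, `α` and `r` -/

lemma unitBallVol_pos (n : ℕ) : 0 < unitBallVol n :=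
  ENNReal.toReal_pos (Metric.measure_ball_pos _ _ one_pos).ne' measure_ball_lt_top.ne

lemma mult_pos (hn : 0 < n) (L : Submodule ℤ (Space n)) [DiscreteTopology L]
    [IsZLattice ℝ L] (j : ℕ) : 0 < mult L j := by
  obtain ⟨x, hx, hxj⟩ := exists_norm_eq_normSeries hn L j
  exact (Set.ncard_pos ((finite_norm_le L (normSeries L j)).subset
    fun y hy => ⟨hy.1, hy.2.le⟩)).2 ⟨x, hx, hxj⟩

lemma alphaOne_pos (hn : 0 < n) (L : Submodule ℤ (Space n)) [DiscreteTopology L]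
    [IsZLattice ℝ L] : 0 < alphaOne L := by
  have h1 := normSeries_pos hn L one_ne_zero
  have h2 : (0 : ℝ) < mult L 1 := by exact_mod_cast mult_pos hn L 1
  have h3 := unitBallVol_pos n
  unfold alphaOne
  positivity

lemma radius_pos (hn : 0 < n) (L : Submodule ℤ (Space n)) [DiscreteTopology L]
    [IsZLattice ℝ L] : 0 < radius L := by
  have h1 := alphaOne_pos hn L
  have h3 := unitBallVol_pos n
  unfold radius
  positivity

lemma mul_radius_pow (hn : 0 < n) (L : Submodule ℤ (Space n)) [DiscreteTopology L]
    [IsZLattice ℝ L] :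
    alphaOne L * Real.exp (n * nld L) * unitBallVol n * radius L ^ n = 1 := by
  have h1 := alphaOne_pos hn L
  have h3 := unitBallVol_pos n
  have h : 0 < alphaOne L * Real.exp (n * nld L) * unitBallVol n := by positivity
  have hn' : (n : ℝ) ≠ 0 := by positivity
  rw [radius, ← Real.rpow_natCast, ← Real.rpow_mul h.le, neg_mul, one_div_mul_cancel hn',
    Real.rpow_neg_one, mul_inv_cancel₀ h.ne']

/-! ### Counting lattice points through `α^rng` -/

lemma normDist_strictMono (hn : 0 < n) (L : Submodule ℤ (Space n)) [DiscreteTopology L]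
    [IsZLattice ℝ L] : StrictMono (normDist L) := fun _ _ h =>
  mul_lt_mul_of_pos_left (normSeries_strictMono hn L h) (Real.exp_pos _)

lemma normDist_nonneg (hn : 0 < n) (L : Submodule ℤ (Space n)) [DiscreteTopology L]
    [IsZLattice ℝ L] (j : ℕ) : 0 ≤ normDist L j :=
  mul_nonneg (Real.exp_pos _).le (normSeries_nonneg hn L j)

lemma alphaRng_normDist_succ (hn : 0 < n) (L : Submodule ℤ (Space n)) [DiscreteTopology L]
    [IsZLattice ℝ L] (j : ℕ) :
    alphaRng L (normDist L (j + 1)) = (mult L (j + 1) : ℝ) /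
      (unitBallVol n * (normDist L (j + 1) ^ n - normDist L j ^ n)) := by
  have hpos : 0 < normDist L (j + 1) :=
    mul_pos (Real.exp_pos _) (normSeries_pos hn L j.succ_ne_zero)
  have hj : sInf {i : ℕ | normDist L (j + 1) ≤ normDist L i} = j + 1 := by
    simp only [(normDist_strictMono hn L).le_iff_le]
    exact csInf_Ici
  simp only [alphaRng, if_pos hpos, hj, Nat.add_sub_cancel]

/-- The first shell starts at `λ̃_0 = 0`, so it fills a whole ball and no inner volume is
subtracted. -/
lemma alphaRng_normDist_one (hn : 0 < n) (L : Submodule ℤ (Space n)) [DiscreteTopology L]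
    [IsZLattice ℝ L] : alphaRng L (normDist L 1) = alphaOne L := by
  have h0 : normDist L 0 = 0 := by simp [normDist, normSeries]
  rw [show (1 : ℕ) = 0 + 1 from rfl, alphaRng_normDist_succ hn L 0, h0, zero_pow hn.ne', sub_zero,
    normDist, mul_pow, ← Real.exp_nat_mul, alphaOne]
  ring_nf

lemma mult_succ_le (hn : 0 < n) (L : Submodule ℤ (Space n)) [DiscreteTopology L]
    [IsZLattice ℝ L]
    (hmono : AntitoneOn (alphaRng L) (Set.Ioc 0 (Real.exp (nld L) * (2 * radius L))))
    {j : ℕ} (hj : normSeries L (j + 1) ≤ 2 * radius L) :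
    (mult L (j + 1) : ℝ) ≤
      alphaOne L * unitBallVol n * (normDist L (j + 1) ^ n - normDist L j ^ n) := by
  have hpos (i : ℕ) : 0 < normDist L (i + 1) :=
    mul_pos (Real.exp_pos _) (normSeries_pos hn L i.succ_ne_zero)
  have hle : normDist L 1 ≤ normDist L (j + 1) := (normDist_strictMono hn L).monotone (by omega)
  have hR : normDist L (j + 1) ≤ Real.exp (nld L) * (2 * radius L) :=
    mul_le_mul_of_nonneg_left hj (Real.exp_pos _).le
  have h := hmono ⟨hpos 0, hle.trans hR⟩ ⟨hpos j, hR⟩ hle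
  have hd : 0 < normDist L (j + 1) ^ n - normDist L j ^ n :=
    sub_pos.2 (pow_lt_pow_left₀ (normDist_strictMono hn L j.lt_succ_self)
      (normDist_nonneg hn L j) hn.ne')
  rw [alphaRng_normDist_succ hn, zero_add, alphaRng_normDist_one hn,
    div_le_iff₀ (mul_pos (unitBallVol_pos n) hd)] at h
  linarith

lemma sum_mult_le (hn : 0 < n) (L : Submodule ℤ (Space n)) [DiscreteTopology L]
    [IsZLattice ℝ L]
    (hmono : AntitoneOn (alphaRng L) (Set.Ioc 0 (Real.exp (nld L) * (2 * radius L))))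
    (J : ℕ) (hJ : normSeries L J ≤ 2 * radius L) :
    ∑ j ∈ Finset.range J, (mult L (j + 1) : ℝ) ≤ alphaOne L * unitBallVol n * normDist L J ^ n := by
  have h0 : normDist L 0 = 0 := by simp [normDist, normSeries]
  calc ∑ j ∈ Finset.range J, (mult L (j + 1) : ℝ)
      ≤ ∑ j ∈ Finset.range J,
          alphaOne L * unitBallVol n * (normDist L (j + 1) ^ n - normDist L j ^ n) := by
        refine Finset.sum_le_sum fun j hj => mult_succ_le hn L hmono ?_
        exact ((normSeries_strictMono hn L).monotone
          (Nat.succ_le_of_lt (Finset.mem_range.1 hj))).trans hJ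
    _ = _ := by
        rw [← Finset.mul_sum, Finset.sum_range_sub (fun j => normDist L j ^ n), h0,
          zero_pow hn.ne', sub_zero]

/-- The number of nonzero lattice vectors of norm at most `ρ ≤ 2r` is bounded by that of a point
process of intensity `α β`. -/
theorem ncard_norm_le (hn : 0 < n) (L : Submodule ℤ (Space n)) [DiscreteTopology L]
    [IsZLattice ℝ L]
    (hmono : AntitoneOn (alphaRng L) (Set.Ioc 0 (Real.exp (nld L) * (2 * radius L))))
    {ρ : ℝ} (hρ0 : 0 ≤ ρ) (hρ : ρ ≤ 2 * radius L) :
    ({x : Space n | x ∈ L ∧ x ≠ 0 ∧ ‖x‖ ≤ ρ}.ncard : ℝ) ≤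
      alphaOne L * Real.exp (n * nld L) * unitBallVol n * ρ ^ n := by
  have hfin : {j : ℕ | normSeries L j ≤ ρ}.Finite := by
    refine Set.Finite.of_finite_image (f := normSeries L)
      (((finite_norm_le L ρ).image norm).subset ?_) (normSeries_strictMono hn L).injective.injOn
    rintro _ ⟨j, hj, rfl⟩
    obtain ⟨y, hy, hyj⟩ := exists_norm_eq_normSeries hn L j
    exact ⟨y, ⟨hy, hyj ▸ hj⟩, hyj⟩
  -- `J` indexes the last norm not exceeding `ρ`. The count is constant from that norm up to `ρ`, so
  -- the bound at `λ_J` suffices.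
  obtain ⟨J, hJ⟩ := hfin.exists_maximal ⟨0, hρ0⟩
  have hsub : {x : Space n | x ∈ L ∧ x ≠ 0 ∧ ‖x‖ ≤ ρ} ⊆
      ⋃ j ∈ Finset.range J, {x : Space n | x ∈ L ∧ ‖x‖ = normSeries L (j + 1)} := by
    rintro x ⟨hx, hx0, hxρ⟩
    obtain ⟨i, hi⟩ := exists_normSeries_eq_norm hn L hx
    have hi0 : i ≠ 0 := by
      rintro rfl
      exact hx0 (norm_eq_zero.1 hi.symm)
    obtain ⟨j, rfl⟩ := Nat.exists_eq_succ_of_ne_zero hi0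
    have : j + 1 ≤ J := by
      by_contra! hlt
      exact hlt.not_ge (hJ.le_of_ge (show normSeries L (j + 1) ≤ ρ from hi.trans_le hxρ) hlt.le)
    simp only [Set.mem_iUnion, Finset.mem_range]
    exact ⟨j, by omega, hx, hi.symm⟩
  have hfinU : (⋃ j ∈ Finset.range J,
      {x : Space n | x ∈ L ∧ ‖x‖ = normSeries L (j + 1)}).Finite :=
    Set.Finite.biUnion (Finset.finite_toSet _) fun j _ =>
      (finite_norm_le L (normSeries L (j + 1))).subset fun y hy => ⟨hy.1, hy.2.le⟩
  have hJρ : normSeries L J ≤ ρ := hJ.prop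
  calc ({x : Space n | x ∈ L ∧ x ≠ 0 ∧ ‖x‖ ≤ ρ}.ncard : ℝ)
      ≤ ∑ j ∈ Finset.range J, (mult L (j + 1) : ℝ) := by
        exact_mod_cast (Set.ncard_le_ncard hsub hfinU).trans
          (Finset.set_ncard_biUnion_le _ _)
    _ ≤ alphaOne L * unitBallVol n * normDist L J ^ n :=
        sum_mult_le hn L hmono J (hJρ.trans hρ)
    _ = alphaOne L * Real.exp (n * nld L) * unitBallVol n * normSeries L J ^ n := by
        rw [normDist, mul_pow, ← Real.exp_nat_mul]; ring
    _ ≤ _ := by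
        have h1 := alphaOne_pos hn L
        have h3 := unitBallVol_pos n
        have h4 := normSeries_nonneg hn L J
        gcongr

/-! ### Isotropy of the noise and pairwise confusion -/

instance isProbabilityMeasure_awgn (σ : ℝ) (n : ℕ) : IsProbabilityMeasure (awgn σ n) :=
  Measure.isProbabilityMeasure_map (by fun_prop)

/-- Dependence on `‖t‖` alone is what yields rotation invariance in `awgn_map`. -/
lemma charFun_awgn (σ : ℝ) (t : Space n) :
    charFun (awgn σ n) t = Complex.exp (-((Real.toNNReal (σ ^ 2) : ℝ) * ‖t‖ ^ 2 / 2 : ℝ)) := by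
  simp_rw [awgn, charFun_pi, charFun_gaussianReal, ← Complex.exp_sum,
    EuclideanSpace.real_norm_sq_eq]
  congr 1
  push_cast
  rw [Finset.mul_sum, Finset.sum_div, ← Finset.sum_neg_distrib]
  refine Finset.sum_congr rfl fun i _ => ?_
  ring

/-- White Gaussian noise is invariant under linear isometries. -/
lemma awgn_map (σ : ℝ) (U : Space n ≃ₗᵢ[ℝ] Space n) : (awgn σ n).map U = awgn σ n := by
  have hU : Measurable U := U.continuous.measurable
  have := Measure.isProbabilityMeasure_map (μ := awgn σ n) hU.aemeasurable
  apply Measure.ext_of_charFun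
  ext t
  have h : charFun ((awgn σ n).map U) t = charFun (awgn σ n) (U.symm t) := by
    rw [charFun_apply, charFun_apply, integral_map hU.aemeasurable (by fun_prop)]
    refine integral_congr_ae (ae_of_all _ fun x => ?_)
    have : inner ℝ (U x) t = inner ℝ x (U.symm t) := by
      rw [← U.inner_map_map x (U.symm t), U.apply_symm_apply]
    simp only [this]
  rw [h, charFun_awgn, charFun_awgn, U.symm.norm_map]

/-- The noise vectors of norm at most `R` that are at least as close to `x` as to `0`. -/
def confusionSet (R : ℝ) (x : Space n) : Set (Space n) := {z | ‖z - x‖ ≤ ‖z‖ ∧ ‖z‖ ≤ R}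

lemma mem_confusionSet_iff {R : ℝ} {x z : Space n} :
    z ∈ confusionSet R x ↔ ‖x‖ ^ 2 ≤ 2 * inner ℝ z x ∧ ‖z‖ ≤ R := by
  rw [confusionSet, Set.mem_ofPred_eq, ← sq_le_sq₀ (norm_nonneg _) (norm_nonneg _),
    norm_sub_sq_real]
  constructor <;> rintro ⟨h1, h2⟩ <;> exact ⟨by linarith, h2⟩

lemma confusionSet_subset_smul (R : ℝ) (y : Space n) {c : ℝ} (hc0 : 0 ≤ c) (hc1 : c ≤ 1) :
    confusionSet R y ⊆ confusionSet R (c • y) := by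
  intro z hz
  rw [mem_confusionSet_iff] at hz ⊢
  refine ⟨?_, hz.2⟩
  rw [norm_smul, mul_pow, Real.norm_of_nonneg hc0, inner_smul_right]
  calc c ^ 2 * ‖y‖ ^ 2 = c * (c * ‖y‖ ^ 2) := by ring
    _ ≤ c * (1 * ‖y‖ ^ 2) := by gcongr
    _ ≤ c * (2 * inner ℝ z y) := by rw [one_mul]; gcongr; exact hz.1
    _ = _ := by ring

lemma preimage_confusionSet (R : ℝ) (U : Space n ≃ₗᵢ[ℝ] Space n) (x : Space n) :
    U ⁻¹' confusionSet R (U x) = confusionSet R x := by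
  ext z
  simp [confusionSet, ← map_sub]

lemma isClosed_setOf_mem_confusionSet (R : ℝ) :
    IsClosed {p : Space n × Space n | p.2 ∈ confusionSet R p.1} := by
  simp only [confusionSet, Set.ofPred_and]
  exact (isClosed_le (by fun_prop) (by fun_prop)).inter (isClosed_le (by fun_prop) (by fun_prop))

lemma isClosed_confusionSet (R : ℝ) (x : Space n) : IsClosed (confusionSet R x) := by
  simp only [confusionSet, Set.ofPred_and]
  exact (isClosed_le (by fun_prop) (by fun_prop)).inter (isClosed_le (by fun_prop) (by fun_prop))

/-- Shrinking `y` to length `‖x‖` enlarges the confusion set, and a reflection carries `x` to the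
shrunken vector while preserving `γ`. -/
lemma measure_confusionSet_anti {γ : Measure (Space n)}
    (hγ : ∀ U : Space n ≃ₗᵢ[ℝ] Space n, γ.map U = γ) (R : ℝ) {x y : Space n} (hxy : ‖x‖ ≤ ‖y‖) :
    γ (confusionSet R y) ≤ γ (confusionSet R x) := by
  rcases eq_or_ne y 0 with rfl | hy
  · rw [norm_zero, norm_le_zero_iff] at hxy
    rw [hxy]
  have hy' : 0 < ‖y‖ := norm_pos_iff.2 hy
  set c := ‖x‖ / ‖y‖ with hc
  have hc0 : 0 ≤ c := by positivity
  have hc1 : c ≤ 1 := div_le_one_of_le₀ hxy hy'.le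
  have hnorm : ‖x‖ = ‖c • y‖ := by
    rw [norm_smul, Real.norm_of_nonneg hc0, hc, div_mul_cancel₀ _ hy'.ne']
  set U : Space n ≃ₗᵢ[ℝ] Space n := (Submodule.span ℝ {x - c • y})ᗮ.reflection
  have hU : U x = c • y := Submodule.reflection_sub hnorm
  calc γ (confusionSet R y) ≤ γ (confusionSet R (c • y)) :=
        measure_mono (confusionSet_subset_smul R y hc0 hc1)
    _ = (γ.map U) (confusionSet R (U x)) := by rw [hγ, hU]
    _ = γ (confusionSet R x) := by
        rw [Measure.map_apply U.continuous.measurable (isClosed_confusionSet R _).measurableSet,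
          preimage_confusionSet]

/-! ### From sums over lattice points to integrals -/

lemma lintegral_ofReal_le_of_meas_lt_le {α : Type*} [MeasurableSpace α] {μ ν : Measure α}
    {f : α → ℝ} (hf0 : 0 ≤ f) (hf : Measurable f)
    (h : ∀ t, 0 < t → μ {a | t < f a} ≤ ν {a | t < f a}) :
    ∫⁻ a, ENNReal.ofReal (f a) ∂μ ≤ ∫⁻ a, ENNReal.ofReal (f a) ∂ν := by
  -- Layer-cake formula: both integrals become integrals over `t > 0` of measures of superlevel
  -- sets.
  rw [lintegral_eq_lintegral_meas_lt μ (ae_of_all _ hf0) hf.aemeasurable,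
    lintegral_eq_lintegral_meas_lt ν (ae_of_all _ hf0) hf.aemeasurable]
  exact setLIntegral_mono' measurableSet_Ioi fun t ht => h t ht

/-- If a finite point set has at most `C · vol (ball 0 ‖x‖)` points in the ball through each of
its points `x`, sums of radially decreasing functions over it are at most `C` times the
integral. -/
lemma sum_ofReal_le_lintegral (F : Finset (Space n)) {C : ℝ}
    (hF : ∀ x ∈ F, ((F.filter fun y => ‖y‖ ≤ ‖x‖).card : ℝ) ≤ C * unitBallVol n * ‖x‖ ^ n)
    {f : Space n → ℝ} (hf0 : 0 ≤ f) (hf : Measurable f)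
    (hanti : ∀ x y, ‖x‖ ≤ ‖y‖ → f y ≤ f x) :
    ∑ x ∈ F, ENNReal.ofReal (f x) ≤ ENNReal.ofReal C * ∫⁻ x, ENNReal.ofReal (f x) := by
  have hL : ∑ x ∈ F, ENNReal.ofReal (f x) =
      ∫⁻ x, ENNReal.ofReal (f x) ∂(∑ x ∈ F, Measure.dirac x) := by
    rw [lintegral_finsetSum_measure]
    exact Finset.sum_congr rfl fun x _ => (lintegral_dirac' x hf.ennreal_ofReal).symm
  rw [hL, ← smul_eq_mul, ← lintegral_smul_measure]
  refine lintegral_ofReal_le_of_meas_lt_le hf0 hf fun t ht => ?_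
  have hms : MeasurableSet {a | t < f a} := measurableSet_lt measurable_const hf
  have hcard : (∑ x ∈ F, Measure.dirac x) {a | t < f a} =
      ((F.filter fun x => t < f x).card : ENNReal) := by
    rw [Measure.finsetSum_apply, Finset.card_filter, Nat.cast_sum]
    refine Finset.sum_congr rfl fun x _ => ?_
    rw [Measure.dirac_apply' _ hms]
    simp [Set.indicator_apply]
  rw [hcard, Measure.smul_apply, smul_eq_mul]
  rcases (F.filter fun x => t < f x).eq_empty_or_nonempty with h | h
  · simp [h]
  obtain ⟨x, hx, hmax⟩ := Finset.exists_max_image _ norm h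
  rw [Finset.mem_filter] at hx
  have hsub : (F.filter fun y => t < f y) ⊆ F.filter fun y => ‖y‖ ≤ ‖x‖ := fun y hy =>
    Finset.mem_filter.2 ⟨(Finset.mem_filter.1 hy).1, hmax y hy⟩
  -- With `x` the farthest point of `F` in the superlevel set, that set contains the whole ball
  -- through `x`, whose volume controls the count.
  have hball : Metric.closedBall (0 : Space n) ‖x‖ ⊆ {a | t < f a} := fun y hy =>
    hx.2.trans_le (hanti y x (by simpa using hy))
  calc ((F.filter fun y => t < f y).card : ENNReal)
      ≤ ((F.filter fun y => ‖y‖ ≤ ‖x‖).card : ENNReal) := by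
        exact_mod_cast Finset.card_le_card hsub
    _ = ENNReal.ofReal ((F.filter fun y => ‖y‖ ≤ ‖x‖).card : ℝ) := by simp
    _ ≤ ENNReal.ofReal (C * (‖x‖ ^ n * unitBallVol n)) :=
        ENNReal.ofReal_le_ofReal ((hF x hx.1).trans_eq (by ring))
    _ = ENNReal.ofReal C * volume (Metric.closedBall (0 : Space n) ‖x‖) := by
        have h0 : 0 ≤ ‖x‖ ^ n * unitBallVol n := by
          have := unitBallVol_pos n
          positivity
        rw [ENNReal.ofReal_mul' h0, Measure.addHaar_closedBall _ _ (norm_nonneg x),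
          finrank_euclideanSpace_fin, ENNReal.ofReal_mul (by positivity), unitBallVol,
          ofReal_measureReal measure_ball_lt_top.ne]
    _ ≤ _ := by gcongr

/-- By Fubini: for fixed `z` with `‖z‖ ≤ R`, the points `x` confusable with `0` form the closed ball
of centre `z` and radius `‖z‖`. -/
lemma lintegral_measure_confusionSet (γ : Measure (Space n)) [SFinite γ] (R : ℝ) :
    ∫⁻ x, γ (confusionSet R x) =
      ∫⁻ z in Metric.closedBall 0 R, ENNReal.ofReal (unitBallVol n * ‖z‖ ^ n) ∂γ := by
  have hms := (isClosed_setOf_mem_confusionSet (n := n) R).measurableSet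
  have h1 := Measure.prod_apply (μ := (volume : Measure (Space n))) (ν := γ) hms
  rw [Measure.prod_apply_symm hms] at h1
  calc ∫⁻ x, γ (confusionSet R x) = _ := h1.symm
    _ = ∫⁻ z, (Metric.closedBall (0 : Space n) R).indicator
          (fun z => ENNReal.ofReal (unitBallVol n * ‖z‖ ^ n)) z ∂γ := by
        refine lintegral_congr fun z => ?_
        by_cases hz : z ∈ Metric.closedBall (0 : Space n) R
        · have : (fun x => (x, z)) ⁻¹' {p : Space n × Space n | p.2 ∈ confusionSet R p.1} =
              Metric.closedBall z ‖z‖ := by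
            ext x
            rw [mem_closedBall_zero_iff] at hz
            simp [confusionSet, hz, dist_eq_norm, norm_sub_rev z x]
          rw [this, Set.indicator_of_mem hz, Measure.addHaar_closedBall _ _ (norm_nonneg z),
            finrank_euclideanSpace_fin, mul_comm, ENNReal.ofReal_mul (unitBallVol_pos n).le,
            unitBallVol, ofReal_measureReal measure_ball_lt_top.ne]
        · have : (fun x => (x, z)) ⁻¹' {p : Space n × Space n | p.2 ∈ confusionSet R p.1} = ∅ := by
            rw [mem_closedBall_zero_iff] at hz
            ext x
            simp [confusionSet, hz]
          rw [this, Set.indicator_of_notMem hz, measure_empty]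
    _ = _ := lintegral_indicator Metric.isClosed_closedBall.measurableSet _

/-! ### The union bound -/

lemma compl_voronoi_subset (L : Submodule ℤ (Space n)) {R : ℝ} {F : Finset (Space n)}
    (hF : ∀ x ∈ L, x ≠ 0 → ‖x‖ ≤ 2 * R → x ∈ F) :
    (voronoi L)ᶜ ⊆ (Metric.closedBall 0 R)ᶜ ∪ ⋃ x ∈ F, confusionSet R x := by
  intro z hz
  by_cases hzR : ‖z‖ ≤ R
  · right
    simp only [voronoi, Set.mem_compl_iff, Set.mem_ofPred_eq, not_forall, not_lt] at hz
    obtain ⟨x, hx, hx0, hxz⟩ := hz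
    -- Noise of norm at most `R` is confused only with points of norm at most `2R`; this is why
    -- monotonicity is needed only up to `2r`.
    have : ‖x‖ ≤ 2 * R := by
      calc ‖x‖ = ‖z - (z - x)‖ := by rw [sub_sub_cancel]
        _ ≤ ‖z‖ + ‖z - x‖ := norm_sub_le _ _
        _ ≤ 2 * R := by linarith
    exact Set.mem_biUnion (hF x hx hx0 this) ⟨hxz, hzR⟩
  · left
    simpa using hzR

/-- The spectral union bound: the lattice performs as well as a Poisson process of intensity
`C = α β`. -/
theorem awgn_compl_voronoi_le (hn : 0 < n) (σ : ℝ) (L : Submodule ℤ (Space n))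
    [DiscreteTopology L] [IsZLattice ℝ L]
    (hmono : AntitoneOn (alphaRng L) (Set.Ioc 0 (Real.exp (nld L) * (2 * radius L)))) :
    awgn σ n (voronoi L)ᶜ ≤ ∫⁻ z, ENNReal.ofReal
      (min 1 (alphaOne L * Real.exp (n * nld L) * unitBallVol n * ‖z‖ ^ n)) ∂awgn σ n := by
  set C := alphaOne L * Real.exp (n * nld L) with hC
  set γ := awgn σ n
  set R := radius L with hR
  have hC0 : 0 < C := mul_pos (alphaOne_pos hn L) (Real.exp_pos _)
  have hR0 : 0 < R := radius_pos hn L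
  have hV := unitBallVol_pos n
  -- So `R` is exactly where the two terms of the minimum cross.
  have hCR : C * unitBallVol n * R ^ n = 1 := mul_radius_pow hn L
  have hfin : {x : Space n | x ∈ L ∧ x ≠ 0 ∧ ‖x‖ ≤ 2 * R}.Finite :=
    (finite_norm_le L (2 * R)).subset fun x hx => ⟨hx.1, hx.2.2⟩
  set F := hfin.toFinset with hFdef
  have hF : ∀ x ∈ F, ((F.filter fun y => ‖y‖ ≤ ‖x‖).card : ℝ) ≤ C * unitBallVol n * ‖x‖ ^ n := by
    intro x hx
    have hx' := (hfin.mem_toFinset.1 hx).2.2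
    refine le_trans ?_ (ncard_norm_le hn L hmono (norm_nonneg x) hx')
    rw [← Set.ncard_coe_finset]
    refine Nat.cast_le.2 (Set.ncard_le_ncard (fun y hy => ?_)
      ((finite_norm_le L ‖x‖).subset fun x hx => ⟨hx.1, hx.2.2⟩))
    rw [Finset.mem_coe, Finset.mem_filter, hfin.mem_toFinset] at hy
    exact ⟨hy.1.1, hy.1.2.1, hy.2⟩
  have hball : MeasurableSet (Metric.closedBall (0 : Space n) R) :=
    Metric.isClosed_closedBall.measurableSet
  have hsum : ∑ x ∈ F, γ (confusionSet R x) ≤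
      ∫⁻ z in Metric.closedBall 0 R, ENNReal.ofReal (C * (unitBallVol n * ‖z‖ ^ n)) ∂γ := by
    have h := sum_ofReal_le_lintegral F hF (f := fun x => γ.real (confusionSet R x))
      (fun x => measureReal_nonneg)
      (measurable_measure_prodMk_left
        (isClosed_setOf_mem_confusionSet (n := n) R).measurableSet).ennreal_toReal
      (fun x y hxy => ENNReal.toReal_mono (measure_ne_top _ _)
        (measure_confusionSet_anti (awgn_map σ) R hxy))
    have hreal (x : Space n) : ENNReal.ofReal (γ.real (confusionSet R x)) = γ (confusionSet R x) :=
      ofReal_measureReal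
    simp only [hreal] at h
    rw [lintegral_measure_confusionSet, ← lintegral_const_mul _ (by fun_prop)] at h
    simpa only [ENNReal.ofReal_mul hC0.le] using h
  calc γ (voronoi L)ᶜ ≤ γ ((Metric.closedBall 0 R)ᶜ ∪ ⋃ x ∈ F, confusionSet R x) :=
        measure_mono (compl_voronoi_subset L fun x h1 h2 h3 => hfin.mem_toFinset.2 ⟨h1, h2, h3⟩)
    _ ≤ γ (Metric.closedBall 0 R)ᶜ + ∑ x ∈ F, γ (confusionSet R x) :=
        (measure_union_le _ _).trans (add_le_add le_rfl (measure_biUnion_finset_le _ _))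
    _ ≤ ∫⁻ z in (Metric.closedBall 0 R)ᶜ, ENNReal.ofReal
            (min 1 (C * unitBallVol n * ‖z‖ ^ n)) ∂γ +
          ∫⁻ z in Metric.closedBall 0 R, ENNReal.ofReal
            (min 1 (C * unitBallVol n * ‖z‖ ^ n)) ∂γ := by
        refine add_le_add ?_ (hsum.trans ?_)
        · rw [← setLIntegral_one]
          refine setLIntegral_mono' hball.compl fun z hz => ?_
          rw [Set.mem_compl_iff, mem_closedBall_zero_iff, not_le] at hz
          rw [min_eq_left, ENNReal.ofReal_one]
          rw [← hCR]
          gcongr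
        · refine setLIntegral_mono' hball fun z hz => ?_
          rw [mem_closedBall_zero_iff] at hz
          rw [min_eq_right, mul_assoc C]
          rw [← hCR]
          gcongr
    _ = _ := by rw [add_comm, lintegral_add_compl _ hball]

/-! ### Gaussian moments and the volume of the ball -/

lemma integral_exp_mul_sq_div_gaussianReal {v : NNReal} (hv : v ≠ 0) {s : ℝ} (hs : s < 1 / 2) :
    ∫ x, Real.exp (s * (x ^ 2 / v)) ∂gaussianReal 0 v = Real.sqrt (1 / (1 - 2 * s)) := by
  have hv' : (0 : ℝ) < v := NNReal.coe_pos.2 (pos_iff_ne_zero.2 hv)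
  have hs' : 0 < 1 - 2 * s := by linarith
  have h (x : ℝ) : gaussianPDFReal 0 v x • Real.exp (s * (x ^ 2 / v)) =
      (Real.sqrt (2 * Real.pi * v))⁻¹ * Real.exp (-((1 - 2 * s) / (2 * v)) * x ^ 2) := by
    rw [gaussianPDFReal, smul_eq_mul, mul_assoc, ← Real.exp_add]
    congr 2
    field_simp
    ring
  rw [integral_gaussianReal_eq_integral_smul hv]
  simp_rw [h]
  rw [integral_const_mul, integral_gaussian, ← Real.sqrt_inv, ← Real.sqrt_mul (by positivity)]
  congr 1
  field_simp

lemma integral_exp_mul_norm_sq_awgn {σ : ℝ} (hσ : 0 < σ) {s : ℝ} (hs : s < 1 / 2) (n : ℕ) :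
    ∫ z, Real.exp (s * (‖z‖ ^ 2 / σ ^ 2)) ∂awgn σ n = Real.sqrt (1 / (1 - 2 * s)) ^ n := by
  have hv : Real.toNNReal (σ ^ 2) ≠ 0 := by positivity
  have hvσ : (Real.toNNReal (σ ^ 2) : ℝ) = σ ^ 2 := Real.coe_toNNReal _ (sq_nonneg σ)
  rw [awgn, integral_map (by fun_prop) (by fun_prop)]
  simp_rw [EuclideanSpace.real_norm_sq_eq, Finset.sum_div, Finset.mul_sum, Real.exp_sum]
  rw [integral_fintype_prod_eq_pow (fun x : ℝ => Real.exp (s * (x ^ 2 / σ ^ 2))), Fintype.card_fin,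
    ← integral_exp_mul_sq_div_gaussianReal hv hs, hvσ]

lemma lintegral_exp_mul_norm_sq_awgn {σ : ℝ} (hσ : 0 < σ) {s : ℝ} (hs : s < 1 / 2) (n : ℕ) :
    ∫⁻ z, ENNReal.ofReal (Real.exp (s * (‖z‖ ^ 2 / σ ^ 2))) ∂awgn σ n =
      ENNReal.ofReal (Real.sqrt (1 / (1 - 2 * s)) ^ n) := by
  have h := integral_exp_mul_norm_sq_awgn hσ hs n
  have hpos : 0 < Real.sqrt (1 / (1 - 2 * s)) ^ n := by
    have : 0 < 1 - 2 * s := by linarith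
    positivity
  -- A non-integrable function has Bochner integral zero by convention, so a positive value forces
  -- integrability.
  have hint : Integrable (fun z => Real.exp (s * (‖z‖ ^ 2 / σ ^ 2))) (awgn σ n) := by
    by_contra hni
    rw [integral_undef hni] at h
    exact hpos.ne h
  rw [← h, ofReal_integral_eq_lintegral_ofReal hint (ae_of_all _ fun z => (Real.exp_pos _).le)]

/-- The integral of `exp(-b‖v‖²)` is at least `V_n e^{-b}`; `b = n/2` optimizes the resulting bound
on `V_n`. -/
lemma unitBallVol_le (hn : 0 < n) :
    unitBallVol n ≤ Real.exp (n / 2 * (Real.log (2 * Real.pi) + 1 - Real.log n)) := by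
  have hn' : (0 : ℝ) < n := Nat.cast_pos.2 hn
  have hb : (0 : ℝ) < n / 2 := by positivity
  have h := GaussianFourier.integral_rexp_neg_mul_sq_norm (V := Space n) hb
  rw [finrank_euclideanSpace_fin] at h
  have hpos : (0 : ℝ) < (Real.pi / (n / 2)) ^ ((n : ℝ) / 2) := by positivity
  have hint : Integrable (fun v : Space n => Real.exp (-(n / 2 : ℝ) * ‖v‖ ^ 2)) := by
    by_contra hni
    rw [integral_undef hni] at h
    exact hpos.ne h
  have hball : MeasurableSet (Metric.ball (0 : Space n) 1) := measurableSet_ball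
  have hle : unitBallVol n * Real.exp (-(n / 2 : ℝ)) ≤ (Real.pi / (n / 2)) ^ ((n : ℝ) / 2) := by
    rw [← h]
    calc unitBallVol n * Real.exp (-(n / 2 : ℝ))
        = ∫ _ in Metric.ball (0 : Space n) 1, Real.exp (-(n / 2 : ℝ)) := by
          rw [setIntegral_const, smul_eq_mul, unitBallVol]
      _ ≤ ∫ v in Metric.ball (0 : Space n) 1, Real.exp (-(n / 2 : ℝ) * ‖v‖ ^ 2) := by
          refine setIntegral_mono_on (integrableOn_const measure_ball_lt_top.ne)
            hint.integrableOn hball fun v hv => Real.exp_le_exp.2 ?_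
          rw [mem_ball_zero_iff] at hv
          have : ‖v‖ ^ 2 ≤ 1 := pow_le_one₀ (norm_nonneg v) hv.le
          nlinarith
      _ ≤ _ := setIntegral_le_integral hint (ae_of_all _ fun v => (Real.exp_pos _).le)
  rw [Real.exp_neg, ← div_eq_mul_inv, div_le_iff₀ (Real.exp_pos _),
    Real.rpow_def_of_pos (by positivity), ← Real.exp_add] at hle
  refine hle.trans_eq ?_
  rw [show Real.pi / (n / 2 : ℝ) = 2 * Real.pi / n by field_simp,
    Real.log_div (by positivity) hn'.ne']
  ring_nf

/-! ### The exponent and the Chernoff bound -/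

/-- The error exponent as a function of `t = log (r² / (n σ²))`, where `r` is the effective
radius. -/
noncomputable def exponentFun (t : ℝ) : ℝ :=
  (Real.exp (max 0 (min t (Real.log 2))) - max 0 (min t (Real.log 2)) - 1) / 2 +
    max (t - Real.log 2) 0 / 2

/-- Clamping glues the three regimes without case splits. Continuity is what absorbs the vanishing
term `(2/n) log α`. -/
lemma continuous_exponentFun : Continuous exponentFun := by
  unfold exponentFun
  fun_prop

lemma exponentFun_of_nonpos {t : ℝ} (ht : t ≤ 0) : exponentFun t = 0 := by
  have h2 : 0 < Real.log 2 := Real.log_pos one_lt_two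
  rw [exponentFun, min_eq_left (ht.trans h2.le), max_eq_left ht, max_eq_right (by linarith)]
  simp

lemma exponentFun_of_mem_Icc {t : ℝ} (h0 : 0 ≤ t) (h1 : t ≤ Real.log 2) :
    exponentFun t = (Real.exp t - t - 1) / 2 := by
  rw [exponentFun, min_eq_left h1, max_eq_right h0, max_eq_right (by linarith)]
  simp

lemma exponentFun_of_log_two_le {t : ℝ} (ht : Real.log 2 ≤ t) :
    exponentFun t = (t + 1) / 2 - Real.log 2 := by
  have h2 : 0 < Real.log 2 := Real.log_pos one_lt_two
  rw [exponentFun, min_eq_right ht, max_eq_right h2.le, max_eq_left (by linarith),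
    Real.exp_log two_pos]
  ring

lemma errorExponent_eq_exponentFun {σ : ℝ} (hσ : 0 < σ) (δ : ℝ) :
    errorExponent σ δ = exponentFun (2 * (deltaStar σ - δ)) := by
  have hcr : deltaCr σ = deltaStar σ - Real.log 2 / 2 := by
    rw [deltaCr, deltaStar, show 1 / (4 * Real.pi * Real.exp 1 * σ ^ 2) =
      1 / (2 * Real.pi * Real.exp 1 * σ ^ 2) / 2 by field_simp; norm_num,
      Real.log_div (by positivity) two_ne_zero]
    ring
  rw [errorExponent, hcr]
  split_ifs with h1 h2
  · rw [exponentFun_of_log_two_le (by linarith), Real.log_div (Real.exp_pos _).ne' (by norm_num),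
      Real.log_exp, show (4 : ℝ) = 2 ^ 2 by norm_num, Real.log_pow]
    push_cast
    ring
  · rw [exponentFun_of_mem_Icc (by linarith) (by linarith)]
  · rw [exponentFun_of_nonpos (by linarith)]

/-- A Chernoff bound for `min 1 (w / eᵗ)`. -/
lemma exists_min_log_le (t : ℝ) : ∃ m, ∀ w, 0 < w →
    min 0 (Real.log w - t) ≤ (1 - Real.exp (-m)) * w - m - 2 * exponentFun t := by
  rcases le_total t 0 with h0 | h0
  · refine ⟨0, fun w _ => ?_⟩
    rw [exponentFun_of_nonpos h0]
    simp
  rcases le_total t (Real.log 2) with h1 | h1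
  -- The right side is a line in `w` through the kink of the left side at `w = e^t`. Its slope `1 -
  -- e^{-t}` is at most the slope `e^{-t}` of the logarithm there precisely because `e^t ≤ 2`.
  · refine ⟨t, fun w hw => ?_⟩
    rw [exponentFun_of_mem_Icc h0 h1]
    have he : Real.exp t ≤ 2 := (Real.le_log_iff_exp_le two_pos).1 h1
    have he1 : 1 ≤ Real.exp t := Real.one_le_exp h0
    have hy0 : 0 < w * Real.exp (-t) := by positivity
    have hlog : Real.log (w * Real.exp (-t)) = Real.log w - t := by
      rw [Real.log_mul hw.ne' (Real.exp_pos _).ne', Real.log_exp, sub_eq_add_neg]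
    have hle := Real.log_le_sub_one_of_pos hy0
    rw [hlog] at hle
    have hr : (1 - Real.exp (-t)) * w - t - 2 * ((Real.exp t - t - 1) / 2) =
        (Real.exp t - 1) * (w * Real.exp (-t) - 1) := by
      have : Real.exp t * Real.exp (-t) = 1 := by rw [← Real.exp_add, add_neg_cancel, Real.exp_zero]
      linear_combination -w * this
    rw [hr]
    rcases le_total 1 (w * Real.exp (-t)) with hy | hy
    · exact (min_le_left _ _).trans (mul_nonneg (by linarith) (by linarith))
    · refine (min_le_right _ _).trans (hle.trans ?_)
      nlinarith
  -- Here the line is tangent to `log w - t` at `w = 2`, where the slope `1/w` equals `1 - e^{-m}`.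
  · refine ⟨Real.log 2, fun w hw => (min_le_right _ _).trans ?_⟩
    rw [exponentFun_of_log_two_le h1, Real.exp_neg, Real.exp_log two_pos]
    have hle := Real.log_le_sub_one_of_pos (half_pos hw)
    rw [Real.log_div hw.ne' two_ne_zero] at hle
    linarith

lemma lintegral_min_one_awgn_le (hn : 0 < n) {σ : ℝ} (hσ : 0 < σ) {A t : ℝ}
    (hA : ∀ z : Space n, z ≠ 0 →
      A * ‖z‖ ^ n ≤ Real.exp (n / 2 * (Real.log (‖z‖ ^ 2 / σ ^ 2 / n) - t))) :
    ∫⁻ z, ENNReal.ofReal (min 1 (A * ‖z‖ ^ n)) ∂awgn σ n ≤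
      ENNReal.ofReal (Real.exp (-(n * exponentFun t))) := by
  have hn' : (0 : ℝ) < n := Nat.cast_pos.2 hn
  obtain ⟨m, hm⟩ := exists_min_log_le t
  -- Then `1 - 2s = e^{-m}`, so the exponential moment is `e^{nm/2}` and cancels the factor
  -- `e^{-nm/2}` in `K`.
  set s := (1 - Real.exp (-m)) / 2 with hs
  have hs2 : s < 1 / 2 := by
    have := Real.exp_pos (-m)
    linarith
  set K := Real.exp (-(n * (m / 2 + exponentFun t))) with hK
  have hpt (z : Space n) : min 1 (A * ‖z‖ ^ n) ≤ K * Real.exp (s * (‖z‖ ^ 2 / σ ^ 2)) := by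
    rcases eq_or_ne z 0 with rfl | hz
    · rw [norm_zero, zero_pow hn.ne', mul_zero]
      exact (min_le_right _ _).trans (by positivity)
    have hw : 0 < ‖z‖ ^ 2 / σ ^ 2 / n := by
      have := norm_pos_iff.2 hz
      positivity
    have h := mul_le_mul_of_nonneg_left (hm _ hw) (show (0 : ℝ) ≤ n / 2 by positivity)
    rw [mul_min_of_nonneg _ _ (by positivity), mul_zero] at h
    calc min 1 (A * ‖z‖ ^ n)
        ≤ min (Real.exp 0) (Real.exp (n / 2 * (Real.log (‖z‖ ^ 2 / σ ^ 2 / n) - t))) := by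
          rw [Real.exp_zero]
          exact min_le_min le_rfl (hA z hz)
      _ = Real.exp (min 0 (n / 2 * (Real.log (‖z‖ ^ 2 / σ ^ 2 / n) - t))) :=
          (Real.exp_monotone.map_min).symm
      _ ≤ Real.exp (-(n * (m / 2 + exponentFun t)) + s * (‖z‖ ^ 2 / σ ^ 2)) := by
          refine Real.exp_le_exp.2 (h.trans_eq ?_)
          rw [hs]
          field_simp
          ring
      _ = _ := Real.exp_add _ _
  have hsqrt : Real.sqrt (1 / (1 - 2 * s)) ^ n = Real.exp (n * (m / 2)) := by
    have : 1 / (1 - 2 * s) = Real.exp (m / 2) ^ 2 := by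
      rw [hs, ← Real.exp_nat_mul, Nat.cast_ofNat, mul_div_cancel₀ _ (two_ne_zero' ℝ),
        mul_div_cancel₀ _ (two_ne_zero' ℝ), sub_sub_cancel, Real.exp_neg, one_div, inv_inv]
    rw [this, Real.sqrt_sq (Real.exp_pos _).le, ← Real.exp_nat_mul]
  calc ∫⁻ z, ENNReal.ofReal (min 1 (A * ‖z‖ ^ n)) ∂awgn σ n
      ≤ ∫⁻ z, ENNReal.ofReal K * ENNReal.ofReal (Real.exp (s * (‖z‖ ^ 2 / σ ^ 2))) ∂awgn σ n := by
        refine lintegral_mono fun z => ?_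
        rw [← ENNReal.ofReal_mul (Real.exp_pos _).le]
        exact ENNReal.ofReal_le_ofReal (hpt z)
    _ = ENNReal.ofReal (K * Real.exp (n * (m / 2))) := by
        rw [lintegral_const_mul _ (by fun_prop), lintegral_exp_mul_norm_sq_awgn hσ hs2, hsqrt,
          ENNReal.ofReal_mul (Real.exp_pos _).le]
    _ = _ := by
        rw [hK, ← Real.exp_add]
        ring_nf

/-- The finite-dimensional error bound behind the main theorem. -/
theorem errorProb_le (hn : 0 < n) {σ : ℝ} (hσ : 0 < σ) (L : Submodule ℤ (Space n))
    [DiscreteTopology L] [IsZLattice ℝ L]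
    (hmono : AntitoneOn (alphaRng L) (Set.Ioc 0 (Real.exp (nld L) * (2 * radius L)))) :
    errorProb σ L ≤ Real.exp (-(n * exponentFun
      (2 * (deltaStar σ - nld L) - 2 * (1 / (n : ℝ) * Real.log (alphaOne L))))) := by
  have hn' : (0 : ℝ) < n := Nat.cast_pos.2 hn
  have hα := alphaOne_pos hn L
  refine ENNReal.toReal_le_of_le_ofReal (Real.exp_pos _).le
    ((awgn_compl_voronoi_le hn σ L hmono).trans (lintegral_min_one_awgn_le hn hσ fun z hz => ?_))
  have hz' := norm_pos_iff.2 hz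
  calc alphaOne L * Real.exp (n * nld L) * unitBallVol n * ‖z‖ ^ n
      ≤ Real.exp (Real.log (alphaOne L)) * Real.exp (n * nld L) *
          Real.exp (n / 2 * (Real.log (2 * Real.pi) + 1 - Real.log n)) *
          Real.exp (n * Real.log ‖z‖) := by
        rw [Real.exp_log hα, Real.exp_nat_mul (Real.log ‖z‖), Real.exp_log hz']
        gcongr
        exact unitBallVol_le hn
    _ = _ := by
        rw [← Real.exp_add, ← Real.exp_add, ← Real.exp_add, deltaStar,
          Real.log_div (by positivity) hn'.ne', Real.log_div (by positivity) (by positivity),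
          Real.log_pow, Real.log_pow, one_div (2 * Real.pi * Real.exp 1 * σ ^ 2), Real.log_inv,
          Real.log_mul (x := 2 * Real.pi * Real.exp 1) (by positivity) (by positivity),
          Real.log_mul (x := 2 * Real.pi) (by positivity) (by positivity),
          Real.log_exp, Real.log_pow]
        congr 1
        push_cast
        field_simp
        ring

end LatticeExponent

theorem mainTheorem10 (σ : ℝ) (hσ : 0 < σ) (δ : ℝ)
    (d : ℕ → ℕ) (hd_pos : ∀ k, 0 < d k) (hd : Tendsto d atTop atTop)
    (Λ : (k : ℕ) → Submodule ℤ (LatticeExponent.Space (d k)))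
    [∀ k, DiscreteTopology (Λ k)] [∀ k, IsZLattice ℝ (Λ k)]
    (hδ : ∀ k, LatticeExponent.nld (Λ k) = δ)
    (hmono : ∀ k, AntitoneOn (LatticeExponent.alphaRng (Λ k))
      (Set.Ioc 0 (Real.exp δ * (2 * LatticeExponent.radius (Λ k)))))
    (hlim : Tendsto (fun k => 1 / (d k : ℝ) * Real.log
        ((LatticeExponent.mult (Λ k) 1 : ℝ) /
          (Real.exp (d k * δ) * LatticeExponent.unitBallVol (d k) *
            LatticeExponent.normSeries (Λ k) 1 ^ d k)))
      atTop (𝓝 0)) :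
    LatticeExponent.AchievesErrorExponent σ δ d Λ := by
  have hα (k : ℕ) : (LatticeExponent.mult (Λ k) 1 : ℝ) /
      (Real.exp (d k * δ) * LatticeExponent.unitBallVol (d k) *
        LatticeExponent.normSeries (Λ k) 1 ^ d k) = LatticeExponent.alphaOne (Λ k) := by
    rw [LatticeExponent.alphaOne, hδ k]
  simp only [hα] at hlim
  -- `ε_k` is the gap between the exponent proved in dimension `d k` and its limit, so the error
  -- bound holds for every `k`, not just eventually.
  refine ⟨fun k => LatticeExponent.exponentFun (2 * (LatticeExponent.deltaStar σ - δ) -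
    2 * (1 / (d k : ℝ) * Real.log (LatticeExponent.alphaOne (Λ k)))) -
      LatticeExponent.errorExponent σ δ, ?_, fun k => ?_⟩
  · rw [LatticeExponent.errorExponent_eq_exponentFun hσ]
    have h := (LatticeExponent.continuous_exponentFun.tendsto _).comp
      ((hlim.const_mul 2).const_sub (2 * (LatticeExponent.deltaStar σ - δ)))
    have h' := h.sub_const (LatticeExponent.exponentFun (2 * (LatticeExponent.deltaStar σ - δ)))
    simpa using h'
  · have h := LatticeExponent.errorProb_le (hd_pos k) hσ (Λ k) (by rw [hδ k]; exact hmono k)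
    rw [hδ k] at h
    rwa [add_sub_cancel]
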